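/- Let $X_1,\dots,X_n$ and $Y$ be random variables on a common probability space with finite state sets, with joint distribution $p(x_1,\dots,x_n,y)$, let $V=\{X_1,\dots,X_n\}$ and $W=V\cup\{Y\}$ (the variables are distinguished by their indices). For distributions $q,r$ on the joint state set write $D_{\mathrm{KL}}(q\|r)=\sum_z q(z)\log\frac{q(z)}{r(z)}$. Let $\mathcal{L}$ be the set of non-empty simplicial complexes over $V$, i.e. non-empty collections $\mathfrak{S}$ of subsets of $V$ that contain every subset of each of their members, ordered by $\mathfrak{S}\le\mathfrak{S}'$ iff every member of $\mathfrak{S}$ is contained in a member of $\mathfrak{S}'$ (the input lattice). Put $\sigma(\mathfrak{S})=2^V\cup\{A\cup\{Y\}:A\in\mathfrak{S}\}$, a simplicial complex over $W$. Let $p_{\mathfrak{S}}$ be the distribution of largest Shannon entropy among all joint distributions $q$ of $X_1,\dots,X_n,Y$ whose marginal on $B$ equals the marginal of $p$ on $B$ for every $B\in\sigma(\mathfrak{S})$. Let $\Gamma$ be the set of maximal chains of $\mathcal{L}$, i.e. of directed paths in its Hasse diagram from $\{\emptyset\}$ to $2^V$. For an edge $(\mathfrak{S},\mathfrak{S}')$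 of the Hasse diagram let $\mu(\mathfrak{S},\mathfrak{S}')$ be the number of chains in $\Gamma$ that contain it, divided by $|\Gamma|$. For $A\subseteq V$ let $\mathcal{E}_A$ be the set of edges $(\mathfrak{S},\mathfrak{S}')$ with $\mathfrak{S}'=\mathfrak{S}\uplus\{A\}$. The information contribution of $A$ is $$I_A(X_1,\dots,X_n;Y)=\sum_{(\mathfrak{S},\mathfrak{S}')\in\mathcal{E}_A}\mu(\mathfrak{S},\mathfrak{S}')\,D_{\mathrm{KL}}(p_{\mathfrak{S}'}\|p_{\mathfrak{S}}).$$ Theorem. These quantities are well defined: for every $\mathfrak{S}\in\mathcal{L}$ the entropy maximiser $p_{\mathfrak{S}}$ exists and is unique, and for $\mathfrak{S}\le\mathfrak{S}'$ every state with $p_{\mathfrak{S}}(z)=0$ has $p_{\mathfrak{S}'}(z)=0$, so that $D_{\mathrm{KL}}(p_{\mathfrak{S}'}\|p_{\mathfrak{S}})$ is finite. Moreover: (I) (nonnegativity) $I_A(X_1,\dots,X_n;Y)\ge 0$ for every $A\subseteq V$. (II) (completeness) $\sum_{A\subseteq V} I_A(X_1,\dots,X_n;Y)=I(X_1,\dots,X_n;Y)$,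 the mutual information between $(X_1,\dots,X_n)$ and $Y$. (III) (symmetry) $I_A(X_1,\dots,X_n;Y)$ is invariant under permutations of $X_1,\dots,X_n$: for every permutation $\pi$ of $\{1,\dots,n\}$, $I_A(X_{\pi(1)},\dots,X_{\pi(n)};Y)=I_A(X_1,\dots,X_n;Y)$, where $A$ denotes the same set of variables on both sides. (IV) (singleton) $I_A(X_1,\dots,X_n;(X_1,\dots,X_n))=0$ if $|A|>1$. (V) (additivity) If $X_i=(X_i',X_i'')$ for all $i$, $Y=(Y',Y'')$, all with finite state sets, and $p(x_1,\dots,x_n,y)=p(x_1',\dots,x_n',y')\,p(x_1'',\dots,x_n'',y'')$, then $$I_A(X_1,\dots,X_n;Y)=I_{A'}(X_1',\dots,X_n';Y')+I_{A''}(X_1'',\dots,X_n'';Y''),$$ where $A'=\{X_i':X_i\in A\}$ and $A''=\{X_i'':X_i\in A\}$. -/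

import Mathlib

open MeasureTheory

namespace InputLattice

section Complexes

/-- A non-empty simplicial complex on the vertex set `V`: a non-empty, downward closed collection
of finite subsets of `V`. The empty simplex is always a member. -/
@[ext]
structure SimpComplex (V : Type*) where
  faces : Set (Finset V)
  nonempty : faces.Nonempty
  down_closed : ∀ A ∈ faces, ∀ B, B ⊆ A → B ∈ faces

variable {V : Type*}

/-- `S ≤ T` if and only if every member of `S` is contained in some member of `T`. -/
instance : PartialOrder (SimpComplex V) where
  le S T := ∀ A ∈ S.faces, ∃ B ∈ T.faces, A ⊆ B
  le_refl S A hA := ⟨A, hA, Finset.Subset.refl A⟩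
  le_trans S T U hST hTU A hA := by
    obtain ⟨B, hB, hAB⟩ := hST A hA
    obtain ⟨C, hC, hBC⟩ := hTU B hB
    exact ⟨C, hC, hAB.trans hBC⟩
  le_antisymm S T hST hTS := by
    ext A
    constructor
    · intro hA
      obtain ⟨B, hB, hAB⟩ := hST A hA
      exact T.down_closed B hB A hAB
    · intro hA
      obtain ⟨B, hB, hAB⟩ := hTS A hA
      exact S.down_closed B hB A hAB

/-- The complex `{∅}`. -/
instance : Bot (SimpComplex V) where
  bot :=
    { faces := {∅}
      nonempty := ⟨∅, rfl⟩
      down_closed := by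
        rintro A rfl B hB
        exact Finset.subset_empty.mp hB }

/-- The complex of all subsets. -/
instance : Top (SimpComplex V) where
  top :=
    { faces := Set.univ
      nonempty := ⟨∅, trivial⟩
      down_closed := fun _ _ _ _ => trivial }

noncomputable instance [Fintype V] : Fintype (SimpComplex V) :=
  @Fintype.ofFinite _ (Finite.of_injective SimpComplex.faces fun _ _ h => SimpComplex.ext h)

/-- The maximal chains: the directed paths in the Hasse diagram from `⊥ = {∅}` to `⊤`. -/
def maxChains (V : Type*) : Set (RelSeries {(S, T) : SimpComplex V × SimpComplex V | S ⋖ T}) :=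
  {γ | γ.head = ⊥ ∧ γ.last = ⊤}

/-- The maximal chains that contain the edge `(S, T)`. -/
def maxChainsThrough (S T : SimpComplex V) :
    Set (RelSeries {(S, T) : SimpComplex V × SimpComplex V | S ⋖ T}) :=
  {γ | γ ∈ maxChains V ∧ ∃ l : Fin γ.length, γ l.castSucc = S ∧ γ l.succ = T}

/-- The weight of an edge under the uniform distribution on the maximal chains. -/
noncomputable def edgeWeight (S T : SimpComplex V) : ℝ :=
  ((maxChainsThrough S T).ncard : ℝ) / ((maxChains V).ncard : ℝ)

/-- The edges `(S, T)` of the Hasse diagram along which the set `A` is added: `T = S ⊎ {A}`. -/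
def edgesAdding (A : Finset V) : Set (SimpComplex V × SimpComplex V) :=
  {e | e.1 ⋖ e.2 ∧ A ∉ e.1.faces ∧ e.2.faces = insert A e.1.faces}

/-- The embedding of the complexes over the inputs into the complexes over all variables. In
`Option V`, the element `some i` stands for the input with index `i`, and `none` for the target.
The members of `sigma S` are the sets of inputs and the sets `A ∪ {target}` with `A ∈ S`. -/
def sigma (S : SimpComplex V) : SimpComplex (Option V) where
  faces := {B | none ∉ B} ∪ {B | ∃ A ∈ S.faces, B = Finset.insertNone A}
  nonempty := ⟨∅, Or.inl (by simp)⟩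
  down_closed := by
    intro B hB C hC
    by_cases hn : none ∈ C
    · right
      rcases hB with hB | ⟨A, hA, rfl⟩
      · exact absurd (hC hn) hB
      · refine ⟨Finset.eraseNone C, S.down_closed A hA _ ?_, ?_⟩
        · intro i hi
          simpa using hC (Finset.mem_eraseNone.mp hi)
        · ext o
          cases o with
          | none => simp [hn]
          | some i => simp
    · exact Or.inl hn

end Complexes

section Distributions

variable {ι : Type*} {𝒳 : ι → Type*} {𝒴 : Type*}

/-- Two joint states of the inputs and the target agree on the variables in `B`. -/
def AgreeOn (B : Finset (Option ι)) (z z' : (∀ i, 𝒳 i) × 𝒴) : Prop :=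
  (∀ i, some i ∈ B → z.1 i = z'.1 i) ∧ (none ∈ B → z.2 = z'.2)

variable [Fintype ι] [∀ i, Fintype (𝒳 i)] [Fintype 𝒴]

open scoped Classical in
/-- The marginal of `q` on the variables in `B`, evaluated at the restriction of `z` to `B`. -/
noncomputable def marginal (q : (∀ i, 𝒳 i) × 𝒴 → ℝ) (B : Finset (Option ι))
    (z : (∀ i, 𝒳 i) × 𝒴) : ℝ :=
  ∑ z' with AgreeOn B z' z, q z'

open scoped Classical in
/-- The distributions that have the same marginals as `p` on all members of `S`. -/
def mixtureFamily (p : (∀ i, 𝒳 i) × 𝒴 → ℝ) (S : SimpComplex (Option ι)) :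
    Set ((∀ i, 𝒳 i) × 𝒴 → ℝ) :=
  {q | q ∈ stdSimplex ℝ ((∀ i, 𝒳 i) × 𝒴) ∧ ∀ B ∈ S.faces, marginal q B = marginal p B}

open scoped Classical in
/-- Shannon entropy (in nats). -/
noncomputable def entropy (q : (∀ i, 𝒳 i) × 𝒴 → ℝ) : ℝ :=
  ∑ z, Real.negMulLog (q z)

open scoped Classical in
/-- Kullback-Leibler divergence `∑ z, q z * log (q z / p z)` (in nats). This is the usual value
whenever `p z = 0` implies `q z = 0`; otherwise the usual value would be `∞`. -/
noncomputable def kl (q p : (∀ i, 𝒳 i) × 𝒴 → ℝ) : ℝ :=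
  ∑ z, q z * Real.log (q z / p z)

/-- `q` has the largest entropy among the distributions in the mixture family of `S`. -/
def IsSplit (p : (∀ i, 𝒳 i) × 𝒴 → ℝ) (S : SimpComplex (Option ι))
    (q : (∀ i, 𝒳 i) × 𝒴 → ℝ) : Prop :=
  q ∈ mixtureFamily p S ∧ IsMaxOn entropy (mixtureFamily p S) q

/-- The split distribution of `S`: the maximiser of the entropy in the mixture family. -/
noncomputable def splitDist (p : (∀ i, 𝒳 i) × 𝒴 → ℝ) (S : SimpComplex (Option ι)) :
    (∀ i, 𝒳 i) × 𝒴 → ℝ :=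
  Classical.epsilon (IsSplit p S)

open scoped Classical in
/-- The mutual information between the tuple of the inputs and the target, that is, the divergence
of `p` from the product of its marginals. -/
noncomputable def mutualInfoDist (p : (∀ i, 𝒳 i) × 𝒴 → ℝ) : ℝ :=
  kl p fun z => (∑ y, p (z.1, y)) * ∑ x, p (x, z.2)

open scoped Classical in
/-- The information contribution of the predictor `A` for the joint distribution `p`. -/
noncomputable def infoContributionDist (p : (∀ i, 𝒳 i) × 𝒴 → ℝ) (A : Finset ι) : ℝ :=
  ∑ e : SimpComplex ι × SimpComplex ι with e ∈ edgesAdding A,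
    edgeWeight e.1 e.2 * kl (splitDist p (sigma e.2)) (splitDist p (sigma e.1))

end Distributions

section RandomVariables

variable {Ω : Type*} [MeasurableSpace Ω] {ι : Type*} {𝒳 : ι → Type*} {𝒴 : Type*}

/-- The joint probability mass function of the inputs `X` and the target `Y`. -/
noncomputable def jointLaw (P : Measure Ω) (X : ∀ i, Ω → 𝒳 i) (Y : Ω → 𝒴) :
    (∀ i, 𝒳 i) × 𝒴 → ℝ :=
  fun z => P.real {ω | (∀ i, X i ω = z.1 i) ∧ Y ω = z.2}

variable [Fintype ι] [∀ i, Fintype (𝒳 i)] [Fintype 𝒴]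

/-- The mutual information `I(X₁, …, Xₙ ; Y)`. -/
noncomputable def mutualInfo (P : Measure Ω) (X : ∀ i, Ω → 𝒳 i) (Y : Ω → 𝒴) : ℝ :=
  mutualInfoDist (jointLaw P X Y)

/-- The information contribution `I_A(X₁, …, Xₙ ; Y)`. -/
noncomputable def infoContribution (P : Measure Ω) (X : ∀ i, Ω → 𝒳 i) (Y : Ω → 𝒴)
    (A : Finset ι) : ℝ :=
  infoContributionDist (jointLaw P X Y) A

end RandomVariables

end InputLattice

open InputLattice

/-! Everything reduces to one function on the input lattice: `splitEntropy p S`, the maximal entropy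
under the constraints of `sigma S`. Compactness and strict concavity of the entropy give a unique
maximiser. Because `negMulLog` has infinite slope at zero, the maximiser charges every state that
any competitor charges (`eq_zero_of_isMaxOn_entropy`). The segment towards a competitor can
therefore be prolonged slightly beyond the maximiser, so the derivative of the entropy vanishes
there (`sum_mul_log_eq_of_isMaxOn_entropy`). This is the Pythagorean relation `kl_splitDist`: each
divergence along an edge is a drop of `splitEntropy`.

The five properties are then properties of that function. Fewer constraints mean more entropy, which
gives nonnegativity. Drops telescope along each maximal chain, so their average over chains is the
drop from `⊥` to `⊤`; the ends are the product of the marginals and `p` itself, which gives the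
mutual information. Permutations act as automorphisms of the lattice and preserve edge weights. If
the inputs are functions of the target, adding a set with at least two elements imposes no new
constraint. For product laws, subadditivity of the entropy makes the product of the two maximisers
the maximiser, so `splitEntropy` is additive. -/

namespace InputLattice

/-! ### Entropy of finite distributions and its maximisers on convex sets. -/

section FiniteEntropy

open Real Finset

variable {α β : Type*} [Fintype α] [Fintype β]

/-- Gibbs' inequality. -/
theorem sum_mul_log_div_nonneg {q r : α → ℝ} (hq : ∀ a, 0 ≤ q a) (hr : ∀ a, 0 ≤ r a)
    (hqr : ∑ a, r a ≤ ∑ a, q a) (h0 : ∀ a, r a = 0 → q a = 0) :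
    0 ≤ ∑ a, q a * log (q a / r a) := by
  have key : ∀ a, q a - r a ≤ q a * log (q a / r a) := by
    intro a
    -- Where `r a > 0` this is `t - 1 ≤ t * log t` at `t = q a / r a`, scaled by `r a`; elsewhere
    -- both sides vanish.
    rcases (hr a).eq_or_lt with h | h
    · simp [h0 a h.symm, ← h]
    · have h1 := self_sub_one_le_mul_log (div_nonneg (hq a) (hr a))
      calc q a - r a = r a * (q a / r a - 1) := by field_simp
        _ ≤ r a * (q a / r a * log (q a / r a)) := by gcongr
        _ = q a * log (q a / r a) := by field_simp
  calc (0 : ℝ) ≤ ∑ a, (q a - r a) := by rw [sum_sub_distrib]; linarith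
    _ ≤ _ := sum_le_sum fun a _ => key a

theorem sum_mul_log_div {q r : α → ℝ} (h0 : ∀ a, r a = 0 → q a = 0) :
    ∑ a, q a * log (q a / r a) = -∑ a, q a * log (r a) - ∑ a, negMulLog (q a) := by
  rw [← sum_neg_distrib, ← sum_sub_distrib]
  refine sum_congr rfl fun a _ => ?_
  by_cases hq : q a = 0
  · simp [hq]
  · rw [log_div hq fun h => hq (h0 a h), negMulLog]
    ring

/-- The entropy of a product distribution. -/
theorem sum_negMulLog_mul {f : α → ℝ} {g : β → ℝ} (hf : ∑ a, f a = 1) (hg : ∑ b, g b = 1) :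
    ∑ z : α × β, negMulLog (f z.1 * g z.2) = ∑ a, negMulLog (f a) + ∑ b, negMulLog (g b) := by
  simp_rw [negMulLog_mul, sum_add_distrib, Fintype.sum_prod_type]
  congr 1
  · simp_rw [← sum_mul, hg, one_mul]
  · rw [sum_comm]
    simp_rw [← sum_mul, hf, one_mul]

/-- Subadditivity of the entropy. -/
theorem sum_negMulLog_le_add {q : α × β → ℝ} (hq : ∀ z, 0 ≤ q z) (h1 : ∑ z, q z = 1) :
    ∑ z, negMulLog (q z) ≤
      ∑ a, negMulLog (∑ b, q (a, b)) + ∑ b, negMulLog (∑ a, q (a, b)) := by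
  set f : α → ℝ := fun a => ∑ b, q (a, b) with hf
  set g : β → ℝ := fun b => ∑ a, q (a, b) with hg
  have hf0 : ∀ a, 0 ≤ f a := fun a => sum_nonneg fun b _ => hq _
  have hg0 : ∀ b, 0 ≤ g b := fun b => sum_nonneg fun a _ => hq _
  have hqf : ∀ a b, f a = 0 → q (a, b) = 0 := fun a b h =>
    (sum_eq_zero_iff_of_nonneg fun b _ => hq (a, b)).mp h b (mem_univ _)
  have hqg : ∀ a b, g b = 0 → q (a, b) = 0 := fun a b h =>
    (sum_eq_zero_iff_of_nonneg fun a _ => hq (a, b)).mp h a (mem_univ _)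
  have hf1 : ∑ a, f a = 1 := by rw [← h1, Fintype.sum_prod_type]
  have hg1 : ∑ b, g b = 1 := by rw [← h1, Fintype.sum_prod_type_right]
  have h0 : ∀ z : α × β, f z.1 * g z.2 = 0 → q z = 0 := by
    rintro ⟨a, b⟩ h
    rcases mul_eq_zero.mp h with h | h
    · exact hqf a b h
    · exact hqg a b h
  -- Gibbs' inequality against the product of the marginals: the mutual information is nonnegative.
  have hG := sum_mul_log_div_nonneg (r := fun z : α × β => f z.1 * g z.2) hq
    (fun z => mul_nonneg (hf0 _) (hg0 _))
    (by simp_rw [h1, Fintype.sum_prod_type, ← mul_sum, hg1, mul_one, hf1, le_refl]) h0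
  rw [sum_mul_log_div h0] at hG
  have hlog : ∀ z : α × β, q z * log (f z.1 * g z.2) = q z * log (f z.1) + q z * log (g z.2) := by
    intro z
    by_cases hz : q z = 0
    · simp [hz]
    · rw [log_mul (fun h => hz (h0 z (by simp [h]))) (fun h => hz (h0 z (by simp [h]))), mul_add]
  have hA : ∑ z : α × β, q z * log (f z.1) = -∑ a, negMulLog (f a) := by
    simp_rw [Fintype.sum_prod_type, ← sum_mul, negMulLog, ← sum_neg_distrib]
    exact sum_congr rfl fun a _ => by simp [hf]
  have hB : ∑ z : α × β, q z * log (g z.2) = -∑ b, negMulLog (g b) := by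
    simp_rw [Fintype.sum_prod_type_right, ← sum_mul, negMulLog, ← sum_neg_distrib]
    exact sum_congr rfl fun a _ => by simp [hg]
  simp_rw [hlog, sum_add_distrib, hA, hB] at hG
  linarith

/-- Each summand is concave, and strictness in one coordinate where the two distributions differ is
enough. -/
theorem strictConcaveOn_sum_negMulLog :
    StrictConcaveOn ℝ (stdSimplex ℝ α) fun q => ∑ a, negMulLog (q a) := by
  refine ⟨convex_stdSimplex ℝ α, fun q hq r hr hqr s t hs ht hst => ?_⟩
  obtain ⟨a₀, ha₀⟩ := Function.ne_iff.mp hqr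
  simp only [smul_sum, ← sum_add_distrib]
  refine sum_lt_sum (fun a _ => ?_) ⟨a₀, mem_univ _, ?_⟩
  · exact concaveOn_negMulLog.2 (hq.1 a) (hr.1 a) hs.le ht.le hst
  · exact strictConcaveOn_negMulLog.2 (hq.1 a₀) (hr.1 a₀) ha₀ hs ht hst

/-- A maximiser of the entropy on a convex set of distributions has the largest support. -/
theorem eq_zero_of_isMaxOn_entropy {K : Set (α → ℝ)} (hK : Convex ℝ K)
    (hKs : K ⊆ stdSimplex ℝ α) {m q : α → ℝ} (hm : m ∈ K)
    (hmax : IsMaxOn (fun q => ∑ a, negMulLog (q a)) K m) (hq : q ∈ K) {a : α} (ha : m a = 0) :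
    q a = 0 := by
  by_contra hne
  have hpos : 0 < q a := lt_of_le_of_ne ((hKs hq).1 a) (Ne.symm hne)
  set C := ∑ a, negMulLog (m a) - ∑ a, negMulLog (q a) with hC
  have hC0 : 0 ≤ C := sub_nonneg.mpr (hmax hq)
  -- Moving from `m` towards `q` by `t` costs at most `t * C` of entropy by concavity, but the empty
  -- state `a` gains an extra `-t * q a * log t`. This choice makes that gain `t * (C + 1)`, a net
  -- increase of at least `t`.
  set t := exp (-(C + 1) / q a) with ht
  have ht0 : 0 < t := exp_pos _
  have ht1 : t ≤ 1 := exp_le_one_iff.mpr (div_nonpos_of_nonpos_of_nonneg (by linarith) hpos.le)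
  have hmem := hK hm hq (sub_nonneg.mpr ht1) ht0.le (by ring)
  have hle : ∑ b, negMulLog (((1 - t) • m + t • q) b) ≤ ∑ b, negMulLog (m b) := hmax hmem
  have hconc : ∀ b, (1 - t) * negMulLog (m b) + t * negMulLog (q b) ≤
      negMulLog (((1 - t) • m + t • q) b) := fun b =>
    concaveOn_negMulLog.2 ((hKs hm).1 b) ((hKs hq).1 b) (sub_nonneg.mpr ht1) ht0.le (by ring)
  have hterm : (1 - t) * negMulLog (m a) + t * negMulLog (q a) + t * (C + 1) ≤
      negMulLog (((1 - t) • m + t • q) a) := by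
    have hlog : log t = -(C + 1) / q a := log_exp _
    have : ((1 - t) • m + t • q) a = t * q a := by simp [ha]
    rw [this, negMulLog_mul, ha, negMulLog_zero, negMulLog, negMulLog, hlog]
    apply le_of_eq
    field_simp
    ring
  have hsum : ∑ b, ((1 - t) * negMulLog (m b) + t * negMulLog (q b)) + t * (C + 1) ≤
      ∑ b, negMulLog (((1 - t) • m + t • q) b) := by
    classical
    rw [← add_sum_erase _ _ (mem_univ a),
      ← add_sum_erase _ (fun b => negMulLog (((1 - t) • m + t • q) b)) (mem_univ a)]
    have := sum_le_sum fun b (_ : b ∈ univ.erase a) => hconc b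
    linarith
  rw [sum_add_distrib, ← mul_sum, ← mul_sum] at hsum
  have : (0 : ℝ) < t := ht0
  nlinarith

/-- The first order condition for a maximum of the entropy at `m` along a line. -/
theorem sum_mul_log_eq_of_isMaxOn_entropy {K : Set (α → ℝ)} (hKs : K ⊆ stdSimplex ℝ α)
    (hext : ∀ q ∈ K, ∀ r ∈ K, ∀ t : ℝ, (∀ a, 0 ≤ q a + t * (r a - q a)) →
      (fun a => q a + t * (r a - q a)) ∈ K)
    {m q : α → ℝ} (hm : m ∈ K) (hmax : IsMaxOn (fun q => ∑ a, negMulLog (q a)) K m) (hq : q ∈ K)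
    (hsupp : ∀ a, m a = 0 → q a = 0) :
    ∑ a, q a * log (m a) = -∑ a, negMulLog (m a) := by
  -- Both signs of `t` are needed for a two-sided maximum. Coordinates where `m` vanishes stay zero
  -- by `hsupp`; the others are positive at `t = 0`.
  have hev : ∀ᶠ t in nhds (0 : ℝ), ∀ a, 0 ≤ m a + t * (q a - m a) := by
    rw [Filter.eventually_all]
    intro a
    rcases ((hKs hm).1 a).eq_or_lt with h | h
    · exact Filter.Eventually.of_forall fun t => by simp [← h, hsupp a h.symm]
    · have hc : ContinuousAt (fun t : ℝ => m a + t * (q a - m a)) 0 := by fun_prop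
      have : ∀ᶠ t in nhds (0 : ℝ), 0 < m a + t * (q a - m a) :=
        hc.eventually_const_lt (by simpa using h)
      exact this.mono fun t ht => ht.le
  have hloc : IsLocalMax (fun t : ℝ => ∑ a, negMulLog (m a + t * (q a - m a))) 0 := by
    filter_upwards [hev] with t ht
    simpa using hmax (hext m hm q hq t ht)
  have hderiv : HasDerivAt (fun t : ℝ => ∑ a, negMulLog (m a + t * (q a - m a)))
      (∑ a, (-log (m a) - 1) * (q a - m a)) 0 := by
    refine HasDerivAt.fun_sum fun a _ => ?_
    by_cases h : m a = 0
    · simp only [h, hsupp a h, sub_self, mul_zero, add_zero]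
      exact hasDerivAt_const _ _
    · have hlin : HasDerivAt (fun t : ℝ => m a + t * (q a - m a)) (q a - m a) 0 := by
        simpa using ((hasDerivAt_id (0 : ℝ)).mul_const (q a - m a)).const_add (m a)
      have hn : HasDerivAt negMulLog (-log (m a) - 1) (m a + 0 * (q a - m a)) := by
        simpa using hasDerivAt_negMulLog h
      exact hn.comp (0 : ℝ) hlin
  have hzero := hloc.hasDerivAt_eq_zero hderiv
  have hsplit : ∑ a, (-log (m a) - 1) * (q a - m a) =
      -∑ a, q a * log (m a) - ∑ a, negMulLog (m a) - ∑ a, q a + ∑ a, m a := by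
    rw [← sum_neg_distrib, ← sum_sub_distrib, ← sum_sub_distrib, ← sum_add_distrib]
    exact sum_congr rfl fun a _ => by rw [negMulLog]; ring
  rw [hsplit, (hKs hm).2, (hKs hq).2] at hzero
  linarith

end FiniteEntropy

/-! ### The input lattice and telescoping along its maximal chains. -/

section Lattice

variable {V : Type*}

theorem SimpComplex.empty_mem (S : SimpComplex V) : ∅ ∈ S.faces :=
  let ⟨A, hA⟩ := S.nonempty
  S.down_closed A hA _ (Finset.empty_subset A)

/-- Downward closure turns containment in some member into membership. -/
theorem SimpComplex.le_iff_faces_subset {S T : SimpComplex V} : S ≤ T ↔ S.faces ⊆ T.faces :=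
  ⟨fun h A hA => let ⟨B, hB, hAB⟩ := h A hA; T.down_closed B hB A hAB,
    fun h A hA => ⟨A, h hA, subset_rfl⟩⟩

theorem SimpComplex.bot_le (S : SimpComplex V) : ⊥ ≤ S :=
  SimpComplex.le_iff_faces_subset.mpr (Set.singleton_subset_iff.mpr S.empty_mem)

theorem SimpComplex.le_top (S : SimpComplex V) : S ≤ ⊤ :=
  SimpComplex.le_iff_faces_subset.mpr (Set.subset_univ _)

theorem sigma_mono {S T : SimpComplex V} (h : S ≤ T) : (sigma S).faces ⊆ (sigma T).faces := by
  rintro B (hB | ⟨A, hA, rfl⟩)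
  · exact Or.inl hB
  · exact Or.inr ⟨A, SimpComplex.le_iff_faces_subset.mp h hA, rfl⟩

/-- Along each edge of the Hasse diagram a single set is added. -/
theorem exists_mem_edgesAdding {S T : SimpComplex V} (h : S ⋖ T) :
    ∃ A, (S, T) ∈ edgesAdding A := by
  have hsub := SimpComplex.le_iff_faces_subset.mp h.le
  have hne : (T.faces \ S.faces).Nonempty := by
    rw [Set.sdiff_nonempty]
    exact fun h' => h.lt.not_ge (SimpComplex.le_iff_faces_subset.mpr h')
  -- A new face of least cardinality has all its proper subsets in `S`, so adjoining it alone yields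
  -- a complex between `S` and `T`.
  obtain ⟨A, ⟨hAT, hAS⟩, hmin⟩ :=
    WellFounded.has_min (measure (Finset.card (α := V))).wf (T.faces \ S.faces) hne
  refine ⟨A, h, hAS, ?_⟩
  let U : SimpComplex V :=
    { faces := insert A S.faces
      nonempty := ⟨A, Set.mem_insert _ _⟩
      down_closed := by
        rintro C (rfl | hC) B hB
        · by_cases hBS : B ∈ S.faces
          · exact Or.inr hBS
          · have hle := hmin B ⟨T.down_closed _ hAT B hB, hBS⟩
            exact Or.inl (Finset.eq_of_subset_of_card_le hB (not_lt.mp hle))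
        · exact Or.inr (S.down_closed C hC B hB) }
  have hSU : S ≤ U := SimpComplex.le_iff_faces_subset.mpr (Set.subset_insert _ _)
  have hUT : U ≤ T :=
    SimpComplex.le_iff_faces_subset.mpr (Set.insert_subset_iff.mpr ⟨hAT, hsub⟩)
  rcases h.eq_or_eq hSU hUT with hU | hU
  · exact absurd (show A ∈ S.faces by rw [← hU]; exact Set.mem_insert _ _) hAS
  · rw [← hU]

theorem edgesAdding_injective {e : SimpComplex V × SimpComplex V} {A B : Finset V}
    (hA : e ∈ edgesAdding A) (hB : e ∈ edgesAdding B) : A = B := by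
  have : A ∈ e.2.faces := by rw [hA.2.2]; exact Set.mem_insert _ _
  rw [hB.2.2] at this
  exact this.resolve_right hA.2.1

/-- Summing over the edges that add `A`, for all `A`, is summing over all edges. -/
theorem sum_edgesAdding [Fintype V] (f : SimpComplex V × SimpComplex V → ℝ) :
    open scoped Classical in
    ∑ A : Finset V, ∑ e : SimpComplex V × SimpComplex V with e ∈ edgesAdding A, f e =
      ∑ e : SimpComplex V × SimpComplex V with e.1 ⋖ e.2, f e := by
  classical
  simp_rw [Finset.sum_filter]
  rw [Finset.sum_comm]
  refine Finset.sum_congr rfl fun e _ => ?_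
  split_ifs with h
  · obtain ⟨A, hA⟩ := exists_mem_edgesAdding h
    rw [Finset.sum_eq_single A, if_pos hA]
    · exact fun B _ hB => if_neg fun h' => hB (edgesAdding_injective h' hA)
    · simp
  · exact Finset.sum_eq_zero fun A _ => if_neg fun h' => h h'.1

theorem relSeries_covBy_strictMono {α : Type*} [PartialOrder α]
    (γ : RelSeries {(a, b) : α × α | a ⋖ b}) : StrictMono γ :=
  Fin.strictMono_iff_lt_succ.mpr fun i => CovBy.lt (γ.step i)

/-- Chains are strictly increasing, hence lists without repetition. Finiteness matters because
`ncard` takes the value zero on infinite sets. -/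
instance relSeries_covBy_finite {α : Type*} [PartialOrder α] [Finite α] :
    Finite (RelSeries {(a, b) : α × α | a ⋖ b}) := by
  cases nonempty_fintype α
  classical
  refine Finite.of_injective
    (β := { l : List α // l.Nodup }) (fun γ => ⟨γ.toList, ?_⟩) fun γ δ h => ?_
  · exact List.nodup_ofFn.mpr (relSeries_covBy_strictMono γ).injective
  · exact RelSeries.toList_injective (congrArg Subtype.val h)

theorem maxChains_nonempty [Finite V] : (maxChains V).Nonempty := by
  cases nonempty_fintype V
  obtain ⟨a, h0, n, hn, hs⟩ := exists_covBy_seq_of_wellFoundedLT_wellFoundedGT_of_le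
    (SimpComplex.bot_le (⊤ : SimpComplex V))
  refine ⟨⟨n, fun i => a i, fun i => hs i i.2⟩, ?_, ?_⟩
  · exact h0
  · exact hn

theorem edgeWeight_nonneg (S T : SimpComplex V) : 0 ≤ edgeWeight S T := by
  unfold edgeWeight
  positivity

/-- The difference of a function between the ends of a maximal chain is the weighted sum of its
increments along all edges. -/
theorem sum_edgeWeight_mul_sub [Fintype V] (h : SimpComplex V → ℝ) :
    open scoped Classical in
    ∑ e : SimpComplex V × SimpComplex V with e.1 ⋖ e.2, edgeWeight e.1 e.2 * (h e.1 - h e.2) =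
      h ⊥ - h ⊤ := by
  classical
  cases nonempty_fintype (RelSeries {(S, T) : SimpComplex V × SimpComplex V | S ⋖ T})
  have hcard : ((maxChains V).ncard : ℝ) ≠ 0 := by
    rw [Nat.cast_ne_zero]
    exact (Set.ncard_pos (Set.toFinite _)).mpr maxChains_nonempty |>.ne'
  have hchain : ∀ γ ∈ (maxChains V).toFinset,
      ∑ e : SimpComplex V × SimpComplex V with e.1 ⋖ e.2,
        (if γ ∈ maxChainsThrough e.1 e.2 then h e.1 - h e.2 else 0) = h ⊥ - h ⊤ := by
    intro γ hγ
    rw [Set.mem_toFinset] at hγ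
    have htel : ∑ l : Fin γ.length, (h (γ l.castSucc) - h (γ l.succ)) = h ⊥ - h ⊤ := by
      rw [← hγ.1, ← hγ.2, RelSeries.head, RelSeries.last]
      have := Fin.sum_univ_succ fun i : Fin (γ.length + 1) => h (γ i)
      have h' := Fin.sum_univ_castSucc fun i : Fin (γ.length + 1) => h (γ i)
      rw [Finset.sum_sub_distrib]
      linarith
    rw [← htel, ← Finset.sum_filter, Finset.filter_filter]
    symm
    -- The steps of a chain correspond to the edges it contains; strict monotonicity prevents an
    -- edge from being counted twice.
    refine Finset.sum_bij (fun l _ => (γ l.castSucc, γ l.succ)) ?_ ?_ ?_ ?_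
    · intro l _
      simp only [Finset.mem_filter, Finset.mem_univ, true_and]
      exact ⟨γ.step l, hγ, l, rfl, rfl⟩
    · intro l _ m _ hlm
      exact Fin.castSucc_injective _
        ((relSeries_covBy_strictMono γ).injective (Prod.ext_iff.mp hlm).1)
    · rintro ⟨S, T⟩ hST
      simp only [Finset.mem_filter, Finset.mem_univ, true_and] at hST
      obtain ⟨-, -, l, rfl, rfl⟩ := hST
      exact ⟨l, Finset.mem_univ _, rfl⟩
    · intro l _
      rfl
  -- An edge weight is the average over chains of the indicator of containing that edge; exchanging
  -- the two sums then leaves the telescoping sums.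
  have hterm : ∀ e : SimpComplex V × SimpComplex V, edgeWeight e.1 e.2 * (h e.1 - h e.2) =
      (∑ γ ∈ (maxChains V).toFinset,
        if γ ∈ maxChainsThrough e.1 e.2 then h e.1 - h e.2 else 0) / (maxChains V).ncard := by
    intro e
    rw [← Finset.sum_filter, Finset.sum_const, nsmul_eq_mul, edgeWeight, div_mul_eq_mul_div]
    congr 3
    rw [Set.ncard_eq_toFinset_card']
    congr 1
    ext γ
    simp only [Set.mem_toFinset, Finset.mem_filter]
    exact ⟨fun h => ⟨h.1, h⟩, fun h => h.2⟩
  rw [Finset.sum_congr rfl fun e _ => hterm e, ← Finset.sum_div, Finset.sum_comm,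
    Finset.sum_congr rfl hchain, Finset.sum_const, nsmul_eq_mul, ← Set.ncard_eq_toFinset_card']
  exact mul_div_cancel_left₀ _ hcard

end Lattice

/-! ### Automorphisms of the input lattice induced by permutations. -/

section Relabelling

variable {V : Type*}

/-- Relabelling the vertices of a complex. -/
def SimpComplex.map (σ : Equiv.Perm V) (S : SimpComplex V) : SimpComplex V where
  faces := {A | A.map σ.symm.toEmbedding ∈ S.faces}
  nonempty := ⟨∅, by simpa using S.empty_mem⟩
  down_closed A hA B hB := S.down_closed _ hA _ (Finset.map_subset_map.mpr hB)

theorem SimpComplex.mem_map {σ : Equiv.Perm V} {S : SimpComplex V} {A : Finset V} :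
    A ∈ (S.map σ).faces ↔ A.map σ.symm.toEmbedding ∈ S.faces :=
  Iff.rfl

/-- Relabelling as an automorphism of the input lattice. -/
def SimpComplex.mapIso (σ : Equiv.Perm V) : SimpComplex V ≃o SimpComplex V where
  toFun := SimpComplex.map σ
  invFun := SimpComplex.map σ.symm
  left_inv S := by ext A; simp [SimpComplex.mem_map, Finset.map_map]
  right_inv S := by ext A; simp [SimpComplex.mem_map, Finset.map_map]
  map_rel_iff' {S T} := by
    simp only [SimpComplex.le_iff_faces_subset]
    refine ⟨fun h A hA => ?_, fun h A hA => h hA⟩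
    have := @h (A.map σ.toEmbedding)
    simp only [Equiv.coe_fn_mk, SimpComplex.mem_map, Finset.map_map] at this
    simpa using this (by simpa using hA)

theorem orderIso_bot (φ : SimpComplex V ≃o SimpComplex V) : φ ⊥ = ⊥ :=
  le_antisymm (by rw [← OrderIso.le_symm_apply]; exact SimpComplex.bot_le _)
    (SimpComplex.bot_le _)

theorem orderIso_top (φ : SimpComplex V ≃o SimpComplex V) : φ ⊤ = ⊤ :=
  le_antisymm (SimpComplex.le_top _)
    (by rw [← OrderIso.symm_apply_le]; exact SimpComplex.le_top _)

/-- An automorphism fixes `⊥` and `⊤` and preserves covering, so it maps maximal chains injectively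
to maximal chains. Applied to `φ.symm` as well, this gives equality. -/
theorem ncard_maxChainsThrough_le [Finite V] (φ : SimpComplex V ≃o SimpComplex V)
    (S T : SimpComplex V) :
    (maxChainsThrough S T).ncard ≤ (maxChainsThrough (φ S) (φ T)).ncard := by
  cases nonempty_fintype V
  refine Set.ncard_le_ncard_of_injOn
    (fun γ => γ.map ⟨φ, fun {a b} h => (apply_covBy_apply_iff φ).mpr h⟩) ?_ ?_ (Set.toFinite _)
  · rintro γ ⟨⟨h0, h1⟩, l, hS, hT⟩
    refine ⟨⟨?_, ?_⟩, l, ?_, ?_⟩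
    · exact (congrArg φ h0).trans (orderIso_bot φ)
    · exact (congrArg φ h1).trans (orderIso_top φ)
    · exact congrArg φ hS
    · exact congrArg φ hT
  · intro γ _ δ _ h
    refine RelSeries.toList_injective (List.map_injective_iff.mpr φ.injective ?_)
    simp only [RelSeries.toList, List.map_ofFn]
    exact congrArg RelSeries.toList h

theorem edgeWeight_orderIso [Finite V] (φ : SimpComplex V ≃o SimpComplex V)
    (S T : SimpComplex V) : edgeWeight (φ S) (φ T) = edgeWeight S T := by
  have h : (maxChainsThrough (φ S) (φ T)).ncard = (maxChainsThrough S T).ncard := by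
    refine le_antisymm ?_ (ncard_maxChainsThrough_le φ S T)
    simpa using ncard_maxChainsThrough_le φ.symm (φ S) (φ T)
  rw [edgeWeight, edgeWeight, h]

theorem mem_edgesAdding_map {σ : Equiv.Perm V} {e : SimpComplex V × SimpComplex V}
    {A : Finset V} :
    (SimpComplex.mapIso σ e.1, SimpComplex.mapIso σ e.2) ∈ edgesAdding (A.map σ.toEmbedding) ↔
      e ∈ edgesAdding A := by
  have hA : (A.map σ.toEmbedding).map σ.symm.toEmbedding = A := by simp [Finset.map_map]
  refine and_congr (apply_covBy_apply_iff _) (and_congr ?_ ?_)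
  · exact not_congr (by simp [SimpComplex.mapIso, SimpComplex.mem_map, Finset.map_map])
  · have hinj : ∀ B : Finset V, B = A.map σ.toEmbedding ↔ B.map σ.symm.toEmbedding = A := by
      intro B
      rw [← hA, Finset.map_inj, hA]
    simp only [Set.ext_iff, Set.mem_insert_iff]
    refine ⟨fun h B => ?_, fun h B => ?_⟩
    · have := h (B.map σ.toEmbedding)
      rw [hinj] at this
      simpa [SimpComplex.mapIso, SimpComplex.mem_map, Finset.map_map] using this
    · rw [hinj]
      exact h (B.map σ.symm.toEmbedding)

end Relabelling

/-! ### Marginal constraints, expressed through expectations. -/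

section MixtureFamily

open scoped Classical
open Real Finset

variable {ι : Type*} {𝒳 : ι → Type*} {𝒴 : Type*}

theorem AgreeOn.refl (B : Finset (Option ι)) (z : (∀ i, 𝒳 i) × 𝒴) : AgreeOn B z z :=
  ⟨fun _ _ => rfl, fun _ => rfl⟩

theorem AgreeOn.symm {B : Finset (Option ι)} {z w : (∀ i, 𝒳 i) × 𝒴} (h : AgreeOn B z w) :
    AgreeOn B w z :=
  ⟨fun i hi => (h.1 i hi).symm, fun hn => (h.2 hn).symm⟩

theorem AgreeOn.trans {B : Finset (Option ι)} {z w v : (∀ i, 𝒳 i) × 𝒴} (h : AgreeOn B z w)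
    (h' : AgreeOn B w v) : AgreeOn B z v :=
  ⟨fun i hi => (h.1 i hi).trans (h'.1 i hi), fun hn => (h.2 hn).trans (h'.2 hn)⟩

variable [Fintype ι] [∀ i, Fintype (𝒳 i)] [Fintype 𝒴]

/-- Two distributions have the same marginal on `B` if and only if they give the same expectation
to all functions of the variables in `B`. -/
theorem marginal_eq_marginal_iff {p q : (∀ i, 𝒳 i) × 𝒴 → ℝ} {B : Finset (Option ι)} :
    marginal q B = marginal p B ↔
      ∀ f : (∀ i, 𝒳 i) × 𝒴 → ℝ, (∀ z w, AgreeOn B z w → f z = f w) →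
        ∑ z, q z * f z = ∑ z, p z * f z := by
  constructor
  · intro h f hf
    let s : Setoid ((∀ i, 𝒳 i) × 𝒴) :=
      ⟨AgreeOn B, AgreeOn.refl B, AgreeOn.symm, AgreeOn.trans⟩
    -- `f` is constant on each class of states agreeing on `B`, and the mass of a class is a value
    -- of the marginal.
    have key : ∀ r : (∀ i, 𝒳 i) × 𝒴 → ℝ, ∑ z, r z * f z =
        ∑ c : Quotient s, marginal r B c.out * f c.out := by
      intro r
      rw [← sum_fiberwise univ (fun z => (Quotient.mk s z))]
      refine sum_congr rfl fun c _ => ?_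
      have hc : ∀ z, Quotient.mk s z = c ↔ AgreeOn B z c.out := by
        intro z
        conv_lhs => rw [← Quotient.out_eq c]
        exact Quotient.eq
      simp_rw [hc, marginal, sum_mul]
      refine sum_congr rfl fun z hz => ?_
      rw [hf z _ (mem_filter.mp hz).2]
    rw [key, key, h]
  · intro h
    ext z
    have := h (fun w => if AgreeOn B w z then 1 else 0) fun w v hwv => by
      have : AgreeOn B w z ↔ AgreeOn B v z := ⟨hwv.symm.trans, hwv.trans⟩
      simp only [this]
    simpa [marginal, sum_filter] using this

theorem mem_mixtureFamily_iff {p q : (∀ i, 𝒳 i) × 𝒴 → ℝ} {S : SimpComplex (Option ι)} :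
    q ∈ mixtureFamily p S ↔ q ∈ stdSimplex ℝ ((∀ i, 𝒳 i) × 𝒴) ∧
      ∀ B ∈ S.faces, ∀ f : (∀ i, 𝒳 i) × 𝒴 → ℝ, (∀ z w, AgreeOn B z w → f z = f w) →
        ∑ z, q z * f z = ∑ z, p z * f z := by
  simp only [mixtureFamily, marginal_eq_marginal_iff, Set.mem_ofPred_eq]

/-- The mixture family of `sigma S` in terms of expectations: it fixes the joint distribution of
the inputs, and that of the target and the inputs in `A` for each `A ∈ S`. -/
theorem mem_mixtureFamily_sigma_iff {p q : (∀ i, 𝒳 i) × 𝒴 → ℝ} {S : SimpComplex ι} :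
    q ∈ mixtureFamily p (sigma S) ↔ q ∈ stdSimplex ℝ ((∀ i, 𝒳 i) × 𝒴) ∧
      (∀ f : (∀ i, 𝒳 i) × 𝒴 → ℝ, (∀ x y y', f (x, y) = f (x, y')) →
        ∑ z, q z * f z = ∑ z, p z * f z) ∧
      ∀ A ∈ S.faces, ∀ f : (∀ i, 𝒳 i) × 𝒴 → ℝ,
        (∀ x x' y, (∀ i ∈ A, x i = x' i) → f (x, y) = f (x', y)) →
        ∑ z, q z * f z = ∑ z, p z * f z := by
  rw [mem_mixtureFamily_iff]
  refine and_congr_right fun _ => ⟨fun h => ⟨fun f hf => ?_, fun A hA f hf => ?_⟩,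
    fun h B hB f hf => ?_⟩
  · refine h (univ.map Function.Embedding.some) (Or.inl (by simp)) f ?_
    rintro ⟨x, y⟩ ⟨x', y'⟩ hz
    obtain rfl : x = x' := funext fun i => hz.1 i (by simp)
    exact hf x y y'
  · refine h (insertNone A) (Or.inr ⟨A, hA, rfl⟩) f ?_
    rintro ⟨x, y⟩ ⟨x', y'⟩ hz
    obtain rfl : y = y' := hz.2 (by simp)
    exact hf x x' y fun i hi => hz.1 i (by simpa using hi)
  · rcases hB with hB | ⟨A, hA, rfl⟩
    · exact h.1 f fun x y y' => hf _ _ ⟨fun _ _ => rfl, fun hn => absurd hn hB⟩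
    · exact h.2 A hA f fun x x' y hx => hf _ _
        ⟨fun i hi => hx i (by simpa using hi), fun _ => rfl⟩

theorem mixtureFamily_subset_stdSimplex (p : (∀ i, 𝒳 i) × 𝒴 → ℝ) (S : SimpComplex (Option ι)) :
    mixtureFamily p S ⊆ stdSimplex ℝ ((∀ i, 𝒳 i) × 𝒴) :=
  fun _ h => h.1

theorem self_mem_mixtureFamily {p : (∀ i, 𝒳 i) × 𝒴 → ℝ}
    (hp : p ∈ stdSimplex ℝ ((∀ i, 𝒳 i) × 𝒴)) (S : SimpComplex (Option ι)) :
    p ∈ mixtureFamily p S :=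
  ⟨hp, fun _ _ => rfl⟩

theorem mixtureFamily_sigma_anti (p : (∀ i, 𝒳 i) × 𝒴 → ℝ) {S T : SimpComplex ι} (h : S ≤ T) :
    mixtureFamily p (sigma T) ⊆ mixtureFamily p (sigma S) :=
  fun _ hq => ⟨hq.1, fun B hB => hq.2 B (sigma_mono h hB)⟩

/-- The mixture family contains the part of each line through two of its points that consists of
non-negative functions. -/
theorem line_mem_mixtureFamily {p : (∀ i, 𝒳 i) × 𝒴 → ℝ} {S : SimpComplex (Option ι)} :
    ∀ q ∈ mixtureFamily p S, ∀ r ∈ mixtureFamily p S, ∀ t : ℝ,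
      (∀ z, 0 ≤ q z + t * (r z - q z)) →
      (fun z => q z + t * (r z - q z)) ∈ mixtureFamily p S := by
  intro q hq r hr t ht
  rw [mem_mixtureFamily_iff] at hq hr ⊢
  refine ⟨⟨ht, ?_⟩, fun B hB f hf => ?_⟩
  · rw [sum_add_distrib, ← mul_sum, sum_sub_distrib, hq.1.2, hr.1.2]
    simp
  · simp_rw [add_mul, mul_assoc, sub_mul]
    rw [sum_add_distrib, ← mul_sum, sum_sub_distrib, hq.2 B hB f hf, hr.2 B hB f hf]
    simp

theorem convex_mixtureFamily (p : (∀ i, 𝒳 i) × 𝒴 → ℝ) (S : SimpComplex (Option ι)) :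
    Convex ℝ (mixtureFamily p S) := by
  intro q hq r hr a b ha hb hab
  have heq : a • q + b • r = fun z => q z + b * (r z - q z) := by
    ext z
    simp only [Pi.add_apply, Pi.smul_apply, smul_eq_mul]
    rw [eq_sub_of_add_eq hab]
    ring
  have hmem := convex_stdSimplex ℝ _ hq.1 hr.1 ha hb hab
  rw [heq] at hmem ⊢
  exact line_mem_mixtureFamily q hq r hr b hmem.1

theorem isCompact_mixtureFamily (p : (∀ i, 𝒳 i) × 𝒴 → ℝ) (S : SimpComplex (Option ι)) :
    IsCompact (mixtureFamily p S) := by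
  refine (isCompact_stdSimplex ℝ _).of_isClosed_subset ?_ (mixtureFamily_subset_stdSimplex p S)
  have : mixtureFamily p S = stdSimplex ℝ ((∀ i, 𝒳 i) × 𝒴) ∩
      ⋂ B ∈ S.faces, {q | marginal q B = marginal p B} := by
    ext q
    simp [mixtureFamily]
  rw [this]
  refine (isClosed_stdSimplex ℝ _).inter (isClosed_biInter fun B _ => ?_)
  refine isClosed_eq (continuous_pi fun z => ?_) continuous_const
  exact continuous_finsetSum _ fun w _ => continuous_apply w

/-! ### Split distributions and the reduction to their entropies. -/

variable {p : (∀ i, 𝒳 i) × 𝒴 → ℝ}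

theorem existsUnique_isSplit (hp : p ∈ stdSimplex ℝ ((∀ i, 𝒳 i) × 𝒴))
    (S : SimpComplex (Option ι)) : ∃! q, IsSplit p S q := by
  have hcont : Continuous (entropy : ((∀ i, 𝒳 i) × 𝒴 → ℝ) → ℝ) :=
    continuous_finsetSum _ fun z _ => continuous_negMulLog.comp (continuous_apply z)
  obtain ⟨q, hq, hmax⟩ := (isCompact_mixtureFamily p S).exists_isMaxOn
    ⟨p, self_mem_mixtureFamily hp S⟩ hcont.continuousOn
  have hconc : StrictConcaveOn ℝ (mixtureFamily p S) entropy :=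
    strictConcaveOn_sum_negMulLog.subset (mixtureFamily_subset_stdSimplex p S)
      (convex_mixtureFamily p S)
  exact ⟨q, ⟨hq, hmax⟩, fun r hr => hconc.eq_of_isMaxOn hr.2 hmax hr.1 hq⟩

theorem isSplit_splitDist (hp : p ∈ stdSimplex ℝ ((∀ i, 𝒳 i) × 𝒴))
    (S : SimpComplex (Option ι)) : IsSplit p S (splitDist p S) :=
  Classical.epsilon_spec (existsUnique_isSplit hp S).exists

theorem IsSplit.splitDist_eq {S : SimpComplex (Option ι)} {q : (∀ i, 𝒳 i) × 𝒴 → ℝ}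
    (h : IsSplit p S q) (hp : p ∈ stdSimplex ℝ ((∀ i, 𝒳 i) × 𝒴)) : splitDist p S = q :=
  (existsUnique_isSplit hp S).unique (isSplit_splitDist hp S) h

/-- The split distribution for `T` also meets the weaker constraints for `S`, and the maximiser
there has the largest support. -/
theorem splitDist_eq_zero_of_le (hp : p ∈ stdSimplex ℝ ((∀ i, 𝒳 i) × 𝒴)) {S T : SimpComplex ι}
    (h : S ≤ T) {z : (∀ i, 𝒳 i) × 𝒴} (hz : splitDist p (sigma S) z = 0) :
    splitDist p (sigma T) z = 0 :=
  eq_zero_of_isMaxOn_entropy (convex_mixtureFamily p _) (mixtureFamily_subset_stdSimplex p _)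
    (isSplit_splitDist hp _).1 (isSplit_splitDist hp _).2
    (mixtureFamily_sigma_anti p h (isSplit_splitDist hp _).1) hz

/-- The largest entropy in the mixture family of `sigma S`. -/
noncomputable def splitEntropy (p : (∀ i, 𝒳 i) × 𝒴 → ℝ) (S : SimpComplex ι) : ℝ :=
  entropy (splitDist p (sigma S))

theorem splitEntropy_eq {S : SimpComplex ι} {q : (∀ i, 𝒳 i) × 𝒴 → ℝ}
    (hp : p ∈ stdSimplex ℝ ((∀ i, 𝒳 i) × 𝒴)) (h : IsSplit p (sigma S) q) :
    splitEntropy p S = entropy q := by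
  rw [splitEntropy, h.splitDist_eq hp]

/-- The Pythagorean relation for split distributions. -/
theorem kl_splitDist (hp : p ∈ stdSimplex ℝ ((∀ i, 𝒳 i) × 𝒴)) {S T : SimpComplex ι}
    (h : S ≤ T) : kl (splitDist p (sigma T)) (splitDist p (sigma S)) =
      splitEntropy p S - splitEntropy p T := by
  have hsupp := fun z => splitDist_eq_zero_of_le hp h (z := z)
  rw [kl, sum_mul_log_div hsupp,
    sum_mul_log_eq_of_isMaxOn_entropy (mixtureFamily_subset_stdSimplex p (sigma S))
      line_mem_mixtureFamily (isSplit_splitDist hp _).1 (isSplit_splitDist hp _).2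
      (mixtureFamily_sigma_anti p h (isSplit_splitDist hp _).1) hsupp, neg_neg]
  rfl

theorem splitEntropy_anti (hp : p ∈ stdSimplex ℝ ((∀ i, 𝒳 i) × 𝒴)) {S T : SimpComplex ι}
    (h : S ≤ T) : splitEntropy p T ≤ splitEntropy p S :=
  (isSplit_splitDist hp _).2 (mixtureFamily_sigma_anti p h (isSplit_splitDist hp _).1)

theorem infoContributionDist_eq (hp : p ∈ stdSimplex ℝ ((∀ i, 𝒳 i) × 𝒴)) (A : Finset ι) :
    infoContributionDist p A =
      ∑ e : SimpComplex ι × SimpComplex ι with e ∈ edgesAdding A,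
        edgeWeight e.1 e.2 * (splitEntropy p e.1 - splitEntropy p e.2) :=
  sum_congr rfl fun e he => by rw [kl_splitDist hp (mem_filter.mp he).2.1.le]

theorem infoContributionDist_nonneg (hp : p ∈ stdSimplex ℝ ((∀ i, 𝒳 i) × 𝒴)) (A : Finset ι) :
    0 ≤ infoContributionDist p A := by
  rw [infoContributionDist_eq hp]
  exact sum_nonneg fun e he => mul_nonneg (edgeWeight_nonneg _ _)
    (sub_nonneg.mpr (splitEntropy_anti hp (mem_filter.mp he).2.1.le))

/-! ### Completeness -/

/-- The full face prescribes the whole joint law, so `p` is the only competitor. -/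
theorem splitDist_top (hp : p ∈ stdSimplex ℝ ((∀ i, 𝒳 i) × 𝒴)) :
    splitDist p (sigma ⊤) = p := by
  refine IsSplit.splitDist_eq ⟨self_mem_mixtureFamily hp _, fun q hq => ?_⟩ hp
  have : q = p := by
    ext z
    have := (mem_mixtureFamily_sigma_iff.mp hq).2.2 univ trivial (fun w => if w = z then 1 else 0)
      fun x x' y hx => by rw [show x = x' from funext fun i => hx i (mem_univ i)]
    simpa using this
  rw [this]
  exact le_refl (entropy p)

/-- Only the laws of the input tuple and of the target are prescribed; by subadditivity,
independence maximises the entropy. -/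
theorem splitDist_bot (hp : p ∈ stdSimplex ℝ ((∀ i, 𝒳 i) × 𝒴)) :
    splitDist p (sigma ⊥) = fun z => (∑ y, p (z.1, y)) * ∑ x, p (x, z.2) := by
  set f : (∀ i, 𝒳 i) → ℝ := fun x => ∑ y, p (x, y) with hf
  set g : 𝒴 → ℝ := fun y => ∑ x, p (x, y) with hg
  have hf1 : ∑ x, f x = 1 := by rw [← hp.2, Fintype.sum_prod_type]
  have hg1 : ∑ y, g y = 1 := by rw [← hp.2, Fintype.sum_prod_type_right]
  refine IsSplit.splitDist_eq ⟨mem_mixtureFamily_sigma_iff.mpr ⟨⟨fun z => ?_, ?_⟩, ?_, ?_⟩,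
    fun q hq => ?_⟩ hp
  · exact mul_nonneg (sum_nonneg fun y _ => hp.1 _) (sum_nonneg fun x _ => hp.1 _)
  · simp_rw [Fintype.sum_prod_type]
    change ∑ x, ∑ y, f x * g y = 1
    simp_rw [← mul_sum, hg1, mul_one, hf1]
  · intro u hu
    simp_rw [Fintype.sum_prod_type]
    refine sum_congr rfl fun x _ => ?_
    change ∑ y, f x * g y * u (x, y) = _
    rcases isEmpty_or_nonempty 𝒴 with h | ⟨⟨y₀⟩⟩
    · simp
    · simp_rw [fun y => hu x y y₀, ← sum_mul, ← mul_sum, hg1, mul_one, hf]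
  · intro A hA u hu
    obtain rfl : A = ∅ := hA
    simp_rw [Fintype.sum_prod_type_right]
    refine sum_congr rfl fun y _ => ?_
    change ∑ x, f x * g y * u (x, y) = _
    rcases isEmpty_or_nonempty (∀ i, 𝒳 i) with h | ⟨⟨x₀⟩⟩
    · simp
    · simp_rw [fun x => hu x x₀ y (by simp), ← sum_mul, hf1, one_mul, hg]
  · have hq' := mem_mixtureFamily_sigma_iff.mp hq
    have hqf : ∀ x, ∑ y, q (x, y) = f x := by
      intro x
      have := hq'.2.1 (fun z => if z.1 = x then 1 else 0) fun _ _ _ => rfl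
      simpa [Fintype.sum_prod_type_right, hf] using this
    have hqg : ∀ y, ∑ x, q (x, y) = g y := by
      intro y
      have := hq'.2.2 ∅ rfl (fun z => if z.2 = y then 1 else 0) fun _ _ _ _ => rfl
      simpa [Fintype.sum_prod_type, hg] using this
    have hsub := sum_negMulLog_le_add hq'.1.1 hq'.1.2
    simp_rw [hqf, hqg] at hsub
    exact hsub.trans_eq (sum_negMulLog_mul hf1 hg1).symm

theorem sum_infoContributionDist (hp : p ∈ stdSimplex ℝ ((∀ i, 𝒳 i) × 𝒴)) :
    ∑ A : Finset ι, infoContributionDist p A = mutualInfoDist p := by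
  simp_rw [infoContributionDist_eq hp]
  rw [sum_edgesAdding fun e => edgeWeight e.1 e.2 * (splitEntropy p e.1 - splitEntropy p e.2),
    sum_edgeWeight_mul_sub, ← kl_splitDist hp (SimpComplex.bot_le ⊤), splitDist_top hp,
    splitDist_bot hp]
  rfl

/-! ### The singleton property -/

/-- If the inputs are functions of the target, then the predictors with at least two inputs do not
contribute. -/
theorem infoContributionDist_eq_zero (hp : p ∈ stdSimplex ℝ ((∀ i, 𝒳 i) × 𝒴))
    (g : 𝒴 → ∀ i, 𝒳 i) (hg : ∀ z, p z ≠ 0 → z.1 = g z.2) {A : Finset ι} (hA : 1 < A.card) :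
    infoContributionDist p A = 0 := by
  rw [infoContributionDist_eq hp]
  refine sum_eq_zero fun e he => ?_
  obtain ⟨hcov, hAS, hT⟩ := (mem_filter.mp he).2
  -- Equal families have the same maximiser, so the entropy drop along the edge is zero.
  suffices h : mixtureFamily p (sigma e.2) = mixtureFamily p (sigma e.1) by
    have hsplit : IsSplit p (sigma e.2) = IsSplit p (sigma e.1) := by
      ext q
      rw [IsSplit, IsSplit, h]
    rw [splitEntropy, splitEntropy, splitDist, splitDist, hsplit, sub_self, mul_zero]
  refine (mixtureFamily_sigma_anti p hcov.le).antisymm fun q hq => ?_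
  rw [mem_mixtureFamily_sigma_iff] at hq ⊢
  refine ⟨hq.1, hq.2.1, fun B hB f hf => ?_⟩
  rw [hT] at hB
  rcases hB with rfl | hB
  swap
  · exact hq.2.2 B hB f hf
  -- As `B` has more than one element, each `{i}` with `i ∈ B` is already a face of `e.1`. The event
  -- that input `i` differs from `g` of the target thus has the same probability under `q` as under
  -- `p`, namely zero.
  have hsupp : ∀ z, q z ≠ 0 → ∀ i ∈ B, z.1 i = g z.2 i := by
    intro z hz i hi
    by_contra hne
    have hiS : {i} ∈ e.1.faces := by
      have : ({i} : Finset ι) ∈ e.2.faces :=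
        e.2.down_closed B (by rw [hT]; exact Set.mem_insert _ _) _ (by simpa using hi)
      rw [hT] at this
      refine this.resolve_left fun h => ?_
      rw [← h] at hA
      simp at hA
    have hsum := hq.2.2 {i} hiS (fun w => if w.1 i = g w.2 i then 0 else 1)
      fun x x' y hx => by simp [hx i (mem_singleton_self i)]
    have hp0 : ∑ w, p w * (if w.1 i = g w.2 i then (0 : ℝ) else 1) = 0 := by
      refine sum_eq_zero fun w _ => ?_
      by_cases hw : p w = 0
      · simp [hw]
      · simp [hg w hw]
    rw [hp0, sum_eq_zero_iff_of_nonneg fun w _ => mul_nonneg (hq.1.1 w) (by split_ifs <;> simp)]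
      at hsum
    exact hz (by simpa [hne] using hsum z (mem_univ z))
  -- On such a support `f` depends on the target alone, whose law is fixed by the empty face.
  have hfun : ∀ r : (∀ i, 𝒳 i) × 𝒴 → ℝ, (∀ z, r z ≠ 0 → ∀ i ∈ B, z.1 i = g z.2 i) →
      ∑ z, r z * f z = ∑ z, r z * f (g z.2, z.2) := by
    intro r hr
    refine sum_congr rfl fun z _ => ?_
    by_cases hz : r z = 0
    · simp [hz]
    · rw [hf (g z.2) z.1 z.2 fun i hi => (hr z hz i hi).symm]
  rw [hfun q hsupp, hfun p fun z hz i _ => by rw [hg z hz]]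
  exact hq.2.2 ∅ e.1.empty_mem _ fun _ _ _ _ => rfl

end MixtureFamily

/-! ### Invariance under permutation of the inputs. -/

section StateRelabelling

open scoped Classical
open Finset

variable {ι : Type*} {𝒳 : ι → Type*} {𝒴 : Type*}

/-- Relabelling the inputs of joint states. -/
def relabelStates (𝒳 : ι → Type*) (𝒴 : Type*) (π : Equiv.Perm ι) :
    (∀ i, 𝒳 (π i)) × 𝒴 ≃ (∀ i, 𝒳 i) × 𝒴 :=
  (Equiv.piCongrLeft 𝒳 π).prodCongr (Equiv.refl 𝒴)

theorem relabelStates_apply_apply (π : Equiv.Perm ι) (z : (∀ i, 𝒳 (π i)) × 𝒴) (i : ι) :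
    (relabelStates 𝒳 𝒴 π z).1 (π i) = z.1 i :=
  Equiv.piCongrLeft_apply_apply 𝒳 π z.1 i

variable [Fintype ι] [∀ i, Fintype (𝒳 i)] [Fintype 𝒴] {p q : (∀ i, 𝒳 i) × 𝒴 → ℝ}

theorem comp_equiv_mem_stdSimplex {α β : Type*} [Fintype α] [Fintype β] (e : α ≃ β)
    {q : β → ℝ} : q ∘ e ∈ stdSimplex ℝ α ↔ q ∈ stdSimplex ℝ β := by
  refine and_congr ⟨fun h b => ?_, fun h a => h _⟩ ?_
  · simpa using h (e.symm b)
  · simp only [Function.comp_apply, e.sum_comp q]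

/-- Position `j` of the relabelled state holds input `π j`, so functions of the inputs in `A` become
functions of the positions in `π.symm` of `A`. -/
theorem comp_relabelStates_mem_mixtureFamily (π : Equiv.Perm ι) {S : SimpComplex ι} :
    q ∘ relabelStates 𝒳 𝒴 π ∈
        mixtureFamily (p ∘ relabelStates 𝒳 𝒴 π) (sigma (SimpComplex.mapIso π.symm S)) ↔
      q ∈ mixtureFamily p (sigma S) := by
  set e := relabelStates 𝒳 𝒴 π with he
  have hsum : ∀ (r f : (∀ i, 𝒳 i) × 𝒴 → ℝ), ∑ z, (r ∘ e) z * f (e z) = ∑ z, r z * f z :=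
    fun r f => e.sum_comp fun z => r z * f z
  have hsum' : ∀ (r : (∀ i, 𝒳 i) × 𝒴 → ℝ) (f : (∀ i, 𝒳 (π i)) × 𝒴 → ℝ),
      ∑ z, (r ∘ e) z * f z = ∑ z, r z * f (e.symm z) := by
    intro r f
    rw [← hsum]
    simp
  rw [mem_mixtureFamily_sigma_iff, mem_mixtureFamily_sigma_iff, comp_equiv_mem_stdSimplex]
  refine and_congr_right fun _ => ⟨fun h => ⟨fun f hf => ?_, fun A hA f hf => ?_⟩,
    fun h => ⟨fun f hf => ?_, fun A hA f hf => ?_⟩⟩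
  · rw [← hsum, ← hsum]
    exact h.1 _ fun x y y' => hf _ _ _
  · rw [← hsum, ← hsum]
    refine h.2 (A.map π.symm.toEmbedding) ?_ _ fun x x' y hx => hf _ _ _ fun i hi => ?_
    · change (A.map π.symm.toEmbedding).map π.symm.symm.toEmbedding ∈ S.faces
      simpa [Finset.map_map] using hA
    · obtain ⟨j, rfl⟩ := π.surjective i
      have := hx j (by simpa using hi)
      exact (Equiv.piCongrLeft_apply_apply 𝒳 π x j).trans
        (this.trans (Equiv.piCongrLeft_apply_apply 𝒳 π x' j).symm)
  · rw [hsum', hsum']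
    exact h.1 _ fun x y y' => hf _ _ _
  · rw [hsum', hsum']
    exact h.2 _ hA _ fun x x' y hx => hf _ _ _ fun i hi => hx (π i) (by simpa using hi)

theorem splitEntropy_comp_relabelStates (hp : p ∈ stdSimplex ℝ ((∀ i, 𝒳 i) × 𝒴))
    (π : Equiv.Perm ι) (S : SimpComplex ι) :
    splitEntropy (p ∘ relabelStates 𝒳 𝒴 π) (SimpComplex.mapIso π.symm S) = splitEntropy p S := by
  set e := relabelStates 𝒳 𝒴 π with he
  have hent : ∀ r : (∀ i, 𝒳 i) × 𝒴 → ℝ, entropy (r ∘ e) = entropy r :=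
    fun r => e.sum_comp fun z => Real.negMulLog (r z)
  obtain ⟨hmem, hmax⟩ := isSplit_splitDist hp (sigma S)
  rw [splitEntropy_eq ((comp_equiv_mem_stdSimplex e).mpr hp)
    (q := splitDist p (sigma S) ∘ e) ⟨?_, fun q hq => ?_⟩, hent]
  · rfl
  · exact (comp_relabelStates_mem_mixtureFamily π).mpr hmem
  · have hq' : (q ∘ e.symm) ∘ e = q := by ext; simp
    rw [← hq'] at hq ⊢
    rw [Set.mem_ofPred, hent, hent]
    exact hmax ((comp_relabelStates_mem_mixtureFamily π).mp hq)

theorem infoContributionDist_comp_relabelStates (hp : p ∈ stdSimplex ℝ ((∀ i, 𝒳 i) × 𝒴))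
    (π : Equiv.Perm ι) (A : Finset ι) :
    infoContributionDist (p ∘ relabelStates 𝒳 𝒴 π) (A.map π.symm.toEmbedding) =
      infoContributionDist p A := by
  rw [infoContributionDist_eq hp, infoContributionDist_eq ((comp_equiv_mem_stdSimplex _).mpr hp)]
  symm
  refine sum_equiv ((SimpComplex.mapIso π.symm).toEquiv.prodCongr
    (SimpComplex.mapIso π.symm).toEquiv) (fun e => ?_) fun e _ => ?_
  · simp only [mem_filter, mem_univ, true_and]
    exact mem_edgesAdding_map.symm
  · simp only [Equiv.prodCongr_apply, Prod.map, OrderIso.coe_toEquiv, edgeWeight_orderIso,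
      splitEntropy_comp_relabelStates hp]

end StateRelabelling

/-! ### Additivity on product distributions. -/

section Product

open scoped Classical
open Real Finset

/-- The two factors are exchanged one at a time, with the other coordinate frozen. -/
theorem sum_prod_mul_eq {α β : Type*} [Fintype α] [Fintype β] {r p : α → ℝ} {s q : β → ℝ}
    {f : α × β → ℝ} (hr : ∀ b, ∑ a, r a * f (a, b) = ∑ a, p a * f (a, b))
    (hs : ∀ a, ∑ b, s b * f (a, b) = ∑ b, q b * f (a, b)) :
    ∑ z : α × β, r z.1 * s z.2 * f z = ∑ z : α × β, p z.1 * q z.2 * f z := by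
  calc ∑ z : α × β, r z.1 * s z.2 * f z = ∑ b, s b * ∑ a, r a * f (a, b) := by
        simp_rw [Fintype.sum_prod_type_right, mul_sum]
        exact sum_congr rfl fun b _ => sum_congr rfl fun a _ => by ring
    _ = ∑ a, p a * ∑ b, s b * f (a, b) := by
        simp_rw [hr, mul_sum]
        rw [sum_comm]
        exact sum_congr rfl fun b _ => sum_congr rfl fun a _ => by ring
    _ = ∑ z : α × β, p z.1 * q z.2 * f z := by
        simp_rw [hs, Fintype.sum_prod_type, mul_sum]
        exact sum_congr rfl fun b _ => sum_congr rfl fun a _ => by ring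

variable {ι : Type*} {𝒳 𝒳' : ι → Type*} {𝒴 𝒴' : Type*}

/-- Pairs of joint states as joint states of pairs. -/
def pairStates (𝒳 𝒳' : ι → Type*) (𝒴 𝒴' : Type*) :
    ((∀ i, 𝒳 i) × 𝒴) × ((∀ i, 𝒳' i) × 𝒴') ≃ (∀ i, 𝒳 i × 𝒳' i) × (𝒴 × 𝒴') where
  toFun z := (fun i => (z.1.1 i, z.2.1 i), (z.1.2, z.2.2))
  invFun z := ((fun i => (z.1 i).1, z.2.1), (fun i => (z.1 i).2, z.2.2))
  left_inv _ := rfl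
  right_inv _ := rfl

variable [Fintype ι] [∀ i, Fintype (𝒳 i)] [∀ i, Fintype (𝒳' i)] [Fintype 𝒴] [Fintype 𝒴']
  {p : (∀ i, 𝒳 i) × 𝒴 → ℝ} {p' : (∀ i, 𝒳' i) × 𝒴' → ℝ}
  {P : (∀ i, 𝒳 i × 𝒳' i) × (𝒴 × 𝒴') → ℝ}

theorem pairStates_sum_mul (r : (∀ i, 𝒳 i × 𝒳' i) × (𝒴 × 𝒴') → ℝ)
    (f : (∀ i, 𝒳 i × 𝒳' i) × (𝒴 × 𝒴') → ℝ) :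
    ∑ z, r z * f z =
      ∑ w, r (pairStates 𝒳 𝒳' 𝒴 𝒴' w) * f (pairStates 𝒳 𝒳' 𝒴 𝒴' w) :=
  ((pairStates 𝒳 𝒳' 𝒴 𝒴').sum_comp fun z => r z * f z).symm

theorem mem_stdSimplex_of_pairStates (hp : p ∈ stdSimplex ℝ ((∀ i, 𝒳 i) × 𝒴))
    (hp' : p' ∈ stdSimplex ℝ ((∀ i, 𝒳' i) × 𝒴'))
    (hP : ∀ z z', P (pairStates 𝒳 𝒳' 𝒴 𝒴' (z, z')) = p z * p' z') :
    P ∈ stdSimplex ℝ ((∀ i, 𝒳 i × 𝒳' i) × (𝒴 × 𝒴')) := by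
  rw [← comp_equiv_mem_stdSimplex (pairStates 𝒳 𝒳' 𝒴 𝒴')]
  refine ⟨fun w => ?_, ?_⟩
  · exact (mul_nonneg (hp.1 w.1) (hp'.1 w.2)).trans_eq (hP w.1 w.2).symm
  · simp only [Fintype.sum_prod_type (α₁ := (∀ i, 𝒳 i) × 𝒴), Function.comp_apply, hP, ← mul_sum,
      hp'.2, mul_one, hp.2]

theorem prod_mem_mixtureFamily
    (hP : ∀ z z', P (pairStates 𝒳 𝒳' 𝒴 𝒴' (z, z')) = p z * p' z') {S : SimpComplex ι}
    {q : (∀ i, 𝒳 i) × 𝒴 → ℝ} {q' : (∀ i, 𝒳' i) × 𝒴' → ℝ}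
    {Q : (∀ i, 𝒳 i × 𝒳' i) × (𝒴 × 𝒴') → ℝ}
    (hQ : ∀ z z', Q (pairStates 𝒳 𝒳' 𝒴 𝒴' (z, z')) = q z * q' z')
    (hq : q ∈ mixtureFamily p (sigma S)) (hq' : q' ∈ mixtureFamily p' (sigma S)) :
    Q ∈ mixtureFamily P (sigma S) := by
  have hQs := mem_stdSimplex_of_pairStates hq.1 hq'.1 hQ
  rw [mem_mixtureFamily_sigma_iff] at hq hq' ⊢
  have hQ' : ∀ w, Q (pairStates 𝒳 𝒳' 𝒴 𝒴' w) = q w.1 * q' w.2 := fun w => hQ w.1 w.2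
  have hP' : ∀ w, P (pairStates 𝒳 𝒳' 𝒴 𝒴' w) = p w.1 * p' w.2 := fun w => hP w.1 w.2
  refine ⟨hQs, fun f hf => ?_, fun A hA f hf => ?_⟩
  · simp only [pairStates_sum_mul, hQ', hP']
    refine sum_prod_mul_eq (f := fun w => f (pairStates 𝒳 𝒳' 𝒴 𝒴' w)) (fun b => ?_) fun a => ?_
    · exact hq.2.1 (fun a => f (pairStates 𝒳 𝒳' 𝒴 𝒴' (a, b))) fun x y y' => hf _ _ _
    · exact hq'.2.1 (fun b => f (pairStates 𝒳 𝒳' 𝒴 𝒴' (a, b))) fun x y y' => hf _ _ _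
  · simp only [pairStates_sum_mul, hQ', hP']
    refine sum_prod_mul_eq (f := fun w => f (pairStates 𝒳 𝒳' 𝒴 𝒴' w)) (fun b => ?_) fun a => ?_
    · exact hq.2.2 A hA (fun a => f (pairStates 𝒳 𝒳' 𝒴 𝒴' (a, b)))
        fun x x' y hx => hf _ _ _ fun i hi => Prod.ext (hx i hi) rfl
    · exact hq'.2.2 A hA (fun b => f (pairStates 𝒳 𝒳' 𝒴 𝒴' (a, b)))
        fun x x' y hx => hf _ _ _ fun i hi => Prod.ext rfl (hx i hi)

/-- A test function of the first components is also one of the pairs, and summing out the second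
factor of `P` leaves `p`. -/
theorem fst_mem_mixtureFamily (hp' : p' ∈ stdSimplex ℝ ((∀ i, 𝒳' i) × 𝒴'))
    (hP : ∀ z z', P (pairStates 𝒳 𝒳' 𝒴 𝒴' (z, z')) = p z * p' z') {S : SimpComplex ι}
    {Q : (∀ i, 𝒳 i × 𝒳' i) × (𝒴 × 𝒴') → ℝ} (hQ : Q ∈ mixtureFamily P (sigma S)) :
    (fun z => ∑ z', Q (pairStates 𝒳 𝒳' 𝒴 𝒴' (z, z'))) ∈ mixtureFamily p (sigma S) := by
  rw [mem_mixtureFamily_sigma_iff] at hQ ⊢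
  have hQf : ∀ f : (∀ i, 𝒳 i) × 𝒴 → ℝ,
      ∑ z, (∑ z', Q (pairStates 𝒳 𝒳' 𝒴 𝒴' (z, z'))) * f z =
        ∑ w, Q w * f ((pairStates 𝒳 𝒳' 𝒴 𝒴').symm w).1 := fun f => by
    rw [pairStates_sum_mul, Fintype.sum_prod_type (α₁ := (∀ i, 𝒳 i) × 𝒴)]
    exact sum_congr rfl fun z _ => sum_mul _ _ _
  have hPf : ∀ f : (∀ i, 𝒳 i) × 𝒴 → ℝ, ∑ z, p z * f z =
        ∑ w, P w * f ((pairStates 𝒳 𝒳' 𝒴 𝒴').symm w).1 := fun f => by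
    rw [pairStates_sum_mul, Fintype.sum_prod_type (α₁ := (∀ i, 𝒳 i) × 𝒴)]
    refine sum_congr rfl fun z _ => ?_
    simp only [hP, Equiv.symm_apply_apply, ← sum_mul, ← mul_sum, hp'.2, mul_one]
  refine ⟨⟨fun z => sum_nonneg fun _ _ => hQ.1.1 _, ?_⟩, fun f hf => ?_, fun A hA f hf => ?_⟩
  · have := hQf fun _ => 1
    simpa [hQ.1.2] using this
  · rw [hQf, hPf]
    exact hQ.2.1 _ fun x y y' => hf _ _ _
  · rw [hQf, hPf]
    exact hQ.2.2 A hA _ fun x x' y hx => hf _ _ _ fun i hi => by simp [hx i hi]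

theorem snd_mem_mixtureFamily (hp : p ∈ stdSimplex ℝ ((∀ i, 𝒳 i) × 𝒴))
    (hP : ∀ z z', P (pairStates 𝒳 𝒳' 𝒴 𝒴' (z, z')) = p z * p' z') {S : SimpComplex ι}
    {Q : (∀ i, 𝒳 i × 𝒳' i) × (𝒴 × 𝒴') → ℝ} (hQ : Q ∈ mixtureFamily P (sigma S)) :
    (fun z' => ∑ z, Q (pairStates 𝒳 𝒳' 𝒴 𝒴' (z, z'))) ∈ mixtureFamily p' (sigma S) := by
  rw [mem_mixtureFamily_sigma_iff] at hQ ⊢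
  have hQf : ∀ f : (∀ i, 𝒳' i) × 𝒴' → ℝ,
      ∑ z', (∑ z, Q (pairStates 𝒳 𝒳' 𝒴 𝒴' (z, z'))) * f z' =
        ∑ w, Q w * f ((pairStates 𝒳 𝒳' 𝒴 𝒴').symm w).2 := fun f => by
    rw [pairStates_sum_mul, Fintype.sum_prod_type_right (α₁ := (∀ i, 𝒳 i) × 𝒴)]
    exact sum_congr rfl fun z _ => sum_mul _ _ _
  have hPf : ∀ f : (∀ i, 𝒳' i) × 𝒴' → ℝ, ∑ z', p' z' * f z' =
        ∑ w, P w * f ((pairStates 𝒳 𝒳' 𝒴 𝒴').symm w).2 := fun f => by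
    rw [pairStates_sum_mul, Fintype.sum_prod_type_right (α₁ := (∀ i, 𝒳 i) × 𝒴)]
    refine sum_congr rfl fun z _ => ?_
    simp only [hP, Equiv.symm_apply_apply, ← sum_mul, hp.2, one_mul]
  refine ⟨⟨fun z => sum_nonneg fun _ _ => hQ.1.1 _, ?_⟩, fun f hf => ?_, fun A hA f hf => ?_⟩
  · have := hQf fun _ => 1
    simpa [hQ.1.2] using this
  · rw [hQf, hPf]
    exact hQ.2.1 _ fun x y y' => hf _ _ _
  · rw [hQf, hPf]
    exact hQ.2.2 A hA _ fun x x' y hx => hf _ _ _ fun i hi => by simp [hx i hi]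

/-- The entropy of the split distributions is additive on product distributions. -/
theorem splitEntropy_prod (hp : p ∈ stdSimplex ℝ ((∀ i, 𝒳 i) × 𝒴))
    (hp' : p' ∈ stdSimplex ℝ ((∀ i, 𝒳' i) × 𝒴'))
    (hP : ∀ z z', P (pairStates 𝒳 𝒳' 𝒴 𝒴' (z, z')) = p z * p' z') (S : SimpComplex ι) :
    splitEntropy P S = splitEntropy p S + splitEntropy p' S := by
  obtain ⟨hm, hmax⟩ := isSplit_splitDist hp (sigma S)
  obtain ⟨hm', hmax'⟩ := isSplit_splitDist hp' (sigma S)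
  set e := pairStates 𝒳 𝒳' 𝒴 𝒴' with he
  have hent : ∀ r : (∀ i, 𝒳 i × 𝒳' i) × (𝒴 × 𝒴') → ℝ,
      entropy r = ∑ w, negMulLog (r (e w)) :=
    fun r => (e.sum_comp fun z => negMulLog (r z)).symm
  set Q : (∀ i, 𝒳 i × 𝒳' i) × (𝒴 × 𝒴') → ℝ := fun z =>
    splitDist p (sigma S) (e.symm z).1 * splitDist p' (sigma S) (e.symm z).2 with hQ
  have hQent : entropy Q = splitEntropy p S + splitEntropy p' S := by
    rw [hent]
    exact sum_negMulLog_mul hm.1.2 hm'.1.2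
  rw [splitEntropy_eq (mem_stdSimplex_of_pairStates hp hp' hP) (q := Q) ⟨?_, fun R hR => ?_⟩, hQent]
  · exact prod_mem_mixtureFamily hP (fun _ _ => rfl) hm hm'
  · rw [Set.mem_ofPred, hQent, hent]
    -- The entropy of a competitor is at most the sum of those of its two component marginals, each
    -- of which competes in its own family.
    have hR' := (comp_equiv_mem_stdSimplex e).mpr hR.1
    exact (sum_negMulLog_le_add hR'.1 hR'.2).trans
      (add_le_add (hmax (fst_mem_mixtureFamily hp' hP hR)) (hmax' (snd_mem_mixtureFamily hp hP hR)))

theorem infoContributionDist_prod (hp : p ∈ stdSimplex ℝ ((∀ i, 𝒳 i) × 𝒴))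
    (hp' : p' ∈ stdSimplex ℝ ((∀ i, 𝒳' i) × 𝒴'))
    (hP : ∀ z z', P (pairStates 𝒳 𝒳' 𝒴 𝒴' (z, z')) = p z * p' z') (A : Finset ι) :
    infoContributionDist P A = infoContributionDist p A + infoContributionDist p' A := by
  rw [infoContributionDist_eq hp, infoContributionDist_eq hp',
    infoContributionDist_eq (mem_stdSimplex_of_pairStates hp hp' hP), ← sum_add_distrib]
  refine sum_congr rfl fun e _ => ?_
  rw [splitEntropy_prod hp hp' hP, splitEntropy_prod hp hp' hP]
  ring

end Product

/-! ### From random variables to their joint law. -/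

section JointLaw

variable {Ω : Type*} [MeasurableSpace Ω] {ι : Type*} {𝒳 : ι → Type*} {𝒴 : Type*}

theorem eq_of_jointLaw_self_ne_zero (P : Measure Ω) (X : ∀ i, Ω → 𝒳 i)
    (z : (∀ i, 𝒳 i) × (∀ i, 𝒳 i)) (hz : jointLaw P X (fun ω i => X i ω) z ≠ 0) : z.1 = z.2 := by
  by_contra hne
  refine hz ?_
  have : {ω | (∀ i, X i ω = z.1 i) ∧ (fun i => X i ω) = z.2} = ∅ := by
    refine Set.eq_empty_of_forall_notMem fun ω hω => hne ?_
    rw [← hω.2]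
    exact funext fun i => (hω.1 i).symm
  rw [jointLaw, this, measureReal_empty]

theorem jointLaw_relabel (P : Measure Ω) (X : ∀ i, Ω → 𝒳 i) (Y : Ω → 𝒴) (π : Equiv.Perm ι) :
    jointLaw P (fun i => X (π i)) Y = jointLaw P X Y ∘ relabelStates 𝒳 𝒴 π := by
  ext z
  have : ∀ ω, (∀ i, X (π i) ω = z.1 i) ↔ ∀ i, X i ω = (relabelStates 𝒳 𝒴 π z).1 i := by
    intro ω
    rw [π.surjective.forall (p := fun i => X i ω = (relabelStates 𝒳 𝒴 π z).1 i)]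
    simp_rw [relabelStates_apply_apply]
  simp only [jointLaw, this, Function.comp_apply]
  rfl

variable [Fintype ι] [∀ i, Fintype (𝒳 i)] [Fintype 𝒴]
  [∀ i, MeasurableSpace (𝒳 i)] [∀ i, MeasurableSingletonClass (𝒳 i)]
  [MeasurableSpace 𝒴] [MeasurableSingletonClass 𝒴]

open scoped Classical in
theorem jointLaw_mem_stdSimplex (P : Measure Ω) [IsProbabilityMeasure P] {X : ∀ i, Ω → 𝒳 i}
    (hX : ∀ i, Measurable (X i)) {Y : Ω → 𝒴} (hY : Measurable Y) :
    jointLaw P X Y ∈ stdSimplex ℝ ((∀ i, 𝒳 i) × 𝒴) := by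
  refine ⟨fun z => measureReal_nonneg, ?_⟩
  have hZ : Measurable fun ω => ((fun i => X i ω, Y ω) : (∀ i, 𝒳 i) × 𝒴) :=
    (measurable_pi_lambda _ hX).prodMk hY
  have hfib : ∀ z : (∀ i, 𝒳 i) × 𝒴, {ω | (∀ i, X i ω = z.1 i) ∧ Y ω = z.2} =
      (fun ω => ((fun i => X i ω, Y ω) : (∀ i, 𝒳 i) × 𝒴)) ⁻¹' {z} := by
    intro z
    ext ω
    simp [Prod.ext_iff, funext_iff]
  simp_rw [jointLaw, hfib]
  rw [sum_measureReal_preimage_singleton _ fun z _ => hZ (measurableSet_singleton z)]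
  simp

end JointLaw

end InputLattice

theorem theorem1 {Ω : Type*} [MeasurableSpace Ω] (P : Measure Ω) [IsProbabilityMeasure P]
    {n : ℕ} {𝒳 : Fin n → Type*} [∀ i, Fintype (𝒳 i)] [∀ i, MeasurableSpace (𝒳 i)]
    [∀ i, MeasurableSingletonClass (𝒳 i)]
    {𝒴 : Type*} [Fintype 𝒴] [MeasurableSpace 𝒴] [MeasurableSingletonClass 𝒴]
    (X : ∀ i, Ω → 𝒳 i) (hX : ∀ i, Measurable (X i)) (Y : Ω → 𝒴) (hY : Measurable Y) :
    -- the quantities are well defined: the maximiser of the entropy exists and is unique, and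
    -- the divergences between comparable split distributions are finite
    (∀ S : SimpComplex (Fin n), ∃! q, IsSplit (jointLaw P X Y) (sigma S) q) ∧
    (∀ S T : SimpComplex (Fin n), S ≤ T → ∀ z,
      splitDist (jointLaw P X Y) (sigma S) z = 0 → splitDist (jointLaw P X Y) (sigma T) z = 0) ∧
    -- (I) nonnegativity
    (∀ A : Finset (Fin n), 0 ≤ infoContribution P X Y A) ∧
    -- (II) completeness
    (∑ A : Finset (Fin n), infoContribution P X Y A = mutualInfo P X Y) ∧
    -- (III) symmetry
    (∀ (π : Equiv.Perm (Fin n)) (A : Finset (Fin n)),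
      infoContribution P (fun i => X (π i)) Y (A.map π.symm.toEmbedding) =
        infoContribution P X Y A) ∧
    -- (IV) singleton property
    (∀ A : Finset (Fin n), 1 < A.card → infoContribution P X (fun ω i => X i ω) A = 0) ∧
    -- (V) additivity
    (∀ {𝒳' 𝒳'' : Fin n → Type*} [∀ i, Fintype (𝒳' i)] [∀ i, Fintype (𝒳'' i)]
      [∀ i, MeasurableSpace (𝒳' i)] [∀ i, MeasurableSpace (𝒳'' i)]
      [∀ i, MeasurableSingletonClass (𝒳' i)] [∀ i, MeasurableSingletonClass (𝒳'' i)]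
      {𝒴' 𝒴'' : Type*} [Fintype 𝒴'] [Fintype 𝒴''] [MeasurableSpace 𝒴'] [MeasurableSpace 𝒴'']
      [MeasurableSingletonClass 𝒴'] [MeasurableSingletonClass 𝒴'']
      (X' : ∀ i, Ω → 𝒳' i) (X'' : ∀ i, Ω → 𝒳'' i) (Y' : Ω → 𝒴') (Y'' : Ω → 𝒴''),
      (∀ i, Measurable (X' i)) → (∀ i, Measurable (X'' i)) → Measurable Y' → Measurable Y'' →
      (∀ (x' : ∀ i, 𝒳' i) (x'' : ∀ i, 𝒳'' i) (y' : 𝒴') (y'' : 𝒴''),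
        jointLaw P (fun i ω => (X' i ω, X'' i ω)) (fun ω => (Y' ω, Y'' ω))
            (fun i => (x' i, x'' i), (y', y'')) =
          jointLaw P X' Y' (x', y') * jointLaw P X'' Y'' (x'', y'')) →
      ∀ A : Finset (Fin n),
        infoContribution P (fun i ω => (X' i ω, X'' i ω)) (fun ω => (Y' ω, Y'' ω)) A =
          infoContribution P X' Y' A + infoContribution P X'' Y'' A) := by
  have hp := jointLaw_mem_stdSimplex P hX hY
  refine ⟨fun S => existsUnique_isSplit hp _, fun S T h z => splitDist_eq_zero_of_le hp h,
    infoContributionDist_nonneg hp, sum_infoContributionDist hp, fun π A => ?_, fun A hA => ?_, ?_⟩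
  -- The variable `X (π i)` now has index `i`, so the same set of variables has the index set `A.map
  -- π.symm.toEmbedding`.
  · rw [infoContribution, jointLaw_relabel]
    exact infoContributionDist_comp_relabelStates hp π A
  -- The target is the input tuple itself, so the inputs are recovered from it by `id`.
  · exact infoContributionDist_eq_zero
      (jointLaw_mem_stdSimplex P hX (measurable_pi_lambda _ hX)) id
      (eq_of_jointLaw_self_ne_zero P X) hA
  · intro 𝒳' 𝒳'' _ _ _ _ _ _ 𝒴' 𝒴'' _ _ _ _ _ _ X' X'' Y' Y'' hX' hX'' hY' hY'' h A
    exact infoContributionDist_prod (jointLaw_mem_stdSimplex P hX' hY')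
      (jointLaw_mem_stdSimplex P hX'' hY'') (fun z z' => h z.1 z'.1 z.2 z'.2) A
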